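/- Let $N$ be a nonempty finite set of $n$ players, let the $m=2^n-1$ coalitions be the nonempty subsets $S\subseteq N$, and for $\eta\in\mathbb R^m$ let $C(\eta)=\{a\in\mathbb R^n:\ \sum_{i\in N}a_i=\eta_N,\ \sum_{i\in S}a_i\ge\eta_S\text{ for all coalitions }S\}$ be the core. Write $\tilde f(t)=\int_0^t f(\tau)\,d\tau$ and $\bar f(t)=\tilde f(t)/t$. Let $\{v(t)\}_{t\ge0}$ be a (jointly measurable) stochastic process of coalition values with values in a bounded convex set $\mathcal V\subset\mathbb R^m$, such that all $v(t)$ have the same law and, for every $t\ge 0$, $\mathbb E[v(t)]=v_{nom}=\lim_{\tau\to\infty}\bar v(\tau)$ almost surely. Let $B_{\mathcal H}$ be the $m\times n$ matrix whose rows are the characteristic vectors of the coalitions and let $B=\left[B_{\mathcal H}\ \Big|\ \begin{array}{c}-I_{m-1}\\0\end{array}\right]$, the zero row belonging to the grand coalition $N$. Given $a_{min},a_{max}\in\mathbb R^n$, let $U=\{(a,s)\in\mathbb R^n\times\mathbb R^{m-1}:\ a_{min}\le a\le a_{max},\ s\ge0\}$. Let $u_{nom}$ satisfy $Bu_{nom}=v_{nom}$,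 let $B^\dagger$ be a right inverse of $B$ (that is, $BB^\dagger=I$), let $\delta>0$, and put $\hat\phi(\sigma)=u_{nom}-\delta B^\dagger\sigma$; assume that $\hat\phi(\mathrm{sgn}(y))\in U$ for all $y\in\mathbb R^m$, where $\mathrm{sgn}$ acts componentwise. (In particular $u_{nom}\in U$, and $C(v_{nom})\neq\emptyset$.) Let the state $x$, with the control $u=(a,s)$, be almost surely a solution on $[0,\infty)$, in the sense of Filippov, of $$\dot x(t)=Bu(t)-v(t),\qquad u(t)=\hat\phi(\mathrm{sgn}(x(t))),$$ that is, $u$ is locally integrable, $x(t)=x(0)+\int_0^t(Bu(\tau)-v(\tau))\,d\tau$ for all $t\ge0$, and for almost every $t\ge 0$ the value $u(t)$ lies in the Filippov convexification of $\hat\phi\circ\mathrm{sgn}$ at $x(t)$. Assume that for each $t\ge0$ the state $x(t)$ is a random vector independent of the fluctuation $v(t)-v_{nom}$. Let the excesses be $\epsilon_S(t)=\sum_{i\in S}\tilde a_i(t)-\tilde v_S(t)+\epsilon_S(0)$ with $\epsilon(0)=x(0)$ (for instance both $0$). Then, with probability one, the average allocation $\bar a(t)$ converges as $t\to\infty$ to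 a point of the core $C(v_{nom})$. Moreover, with probability one, the excess vector $\epsilon(t)$ converges to the nonnegative orthant: $\mathrm{dist}(\epsilon(t),\mathbb R_+^m)\to0$, and for every coalition $S$ the limit $\lim_{t\to\infty}\epsilon_S(t)$ exists in $[0,+\infty]$. -/

import Mathlib

open MeasureTheory ProbabilityTheory Filter Topology

noncomputable section

/-- The nonempty coalitions of a set `ι` of players. -/
abbrev Coalition (ι : Type*) : Type _ := {S : Finset ι // S.Nonempty}

/-- The nonempty coalitions other than the grand coalition. -/
abbrev ProperCoalition (ι : Type*) [Fintype ι] : Type _ :=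
  {S : Finset ι // S.Nonempty ∧ S ≠ Finset.univ}

/-- The grand coalition. -/
def grandCoalition (ι : Type*) [Fintype ι] [Nonempty ι] : Coalition ι :=
  ⟨Finset.univ, Finset.univ_nonempty⟩

/-- The core of the TU game with characteristic function `η`. -/
def core {ι : Type*} [Fintype ι] [Nonempty ι] (η : Coalition ι → ℝ) : Set (ι → ℝ) :=
  {x | ∑ i, x i = η (grandCoalition ι) ∧ ∀ S : Coalition ι, η S ≤ ∑ i ∈ S.1, x i}

/-- The incidence matrix of the coalition hypergraph: its rows are the characteristic vectors. -/
def incidenceMatrix (ι : Type*) [DecidableEq ι] : Matrix (Coalition ι) ι ℝ :=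
  Matrix.of fun S i => if i ∈ S.1 then 1 else 0

/-- The block of the surplus variables: minus the identity on the proper coalitions, and a zero
row for the grand coalition. -/
def surplusMatrix (ι : Type*) [Fintype ι] [DecidableEq ι] :
    Matrix (Coalition ι) (ProperCoalition ι) ℝ :=
  Matrix.of fun S T => if T.1 = S.1 then -1 else 0

/-- The matrix `B` of the flow dynamics `x' = B u - v`, where `u = (a, s)`. -/
def flowMatrix (ι : Type*) [Fintype ι] [DecidableEq ι] :
    Matrix (Coalition ι) (ι ⊕ ProperCoalition ι) ℝ :=
  Matrix.fromCols (incidenceMatrix ι) (surplusMatrix ι)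

/-- Feasible controls `u = (a, s)`: `a` in the box `[aMin, aMax]`, and `s ≥ 0`. -/
def feasibleControls {ι : Type*} [Fintype ι] (aMin aMax : ι → ℝ) :
    Set (ι ⊕ ProperCoalition ι → ℝ) :=
  {u | (∀ i, aMin i ≤ u (Sum.inl i) ∧ u (Sum.inl i) ≤ aMax i) ∧ ∀ T, 0 ≤ u (Sum.inr T)}

/-- The integral of `f` up to time `t`. -/
def cumulative {E : Type*} [NormedAddCommGroup E] [NormedSpace ℝ E] (f : ℝ → E) (t : ℝ) : E :=
  ∫ τ in (0 : ℝ)..t, f τ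

/-- The average of `f` up to time `t`. -/
def timeAverage {E : Type*} [NormedAddCommGroup E] [NormedSpace ℝ E] (f : ℝ → E) (t : ℝ) : E :=
  t⁻¹ • cumulative f t

/-- `v` is a bounded mean ergodic process of coalition values: it lives in the bounded convex set
`V`, all `v t` have the law `P`, and their expected value `vnom` is almost surely the long run
time average. -/
structure IsBoundedMeanErgodic {ι : Type*} [Fintype ι] {Ω : Type*} [MeasurableSpace Ω]
    (μ : Measure Ω) (V : Set (Coalition ι → ℝ)) (P : Measure (Coalition ι → ℝ))
    (vnom : Coalition ι → ℝ) (v : ℝ → Ω → Coalition ι → ℝ) : Prop where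
  bounded : Bornology.IsBounded V
  convex : Convex ℝ V
  measurable : Measurable (Function.uncurry v)
  mem : ∀ᵐ ω ∂μ, ∀ t, 0 ≤ t → v t ω ∈ V
  law : ∀ t, 0 ≤ t → μ.map (v t) = P
  mean : ∀ t, 0 ≤ t → ∫ ω, v t ω ∂μ = vnom
  ergodic : ∀ᵐ ω ∂μ, Tendsto (timeAverage fun τ => v τ ω) atTop (𝓝 vnom)

/-- The componentwise sign of a vector. -/
def sgn {κ : Type*} (x : κ → ℝ) : κ → ℝ := fun j => Real.sign (x j)

/-- The sign-based controller: `unom - δ B† σ`, where `σ` is the observed sign vector. -/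
def signController {ι : Type*} [Fintype ι]
    (unom : ι ⊕ ProperCoalition ι → ℝ) (δ : ℝ)
    (Bdag : Matrix (ι ⊕ ProperCoalition ι) (Coalition ι) ℝ) (σ : Coalition ι → ℝ) :
    ι ⊕ ProperCoalition ι → ℝ :=
  unom - δ • Bdag.mulVec σ

/-- Filippov's convex regularization of a discontinuous map `g` at the point `x`. -/
def filippovSet {E F : Type*} [PseudoMetricSpace E] [MeasureSpace E]
    [NormedAddCommGroup F] [NormedSpace ℝ F] (g : E → F) (x : E) : Set F :=
  ⋂ (r : ℝ) (_ : 0 < r) (N : Set E) (_ : volume N = 0),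
    closure (convexHull ℝ (g '' (Metric.ball x r \ N)))

/-- The path `x`, with the control path `u`, is a solution on `[0, ∞)`, in the sense of Filippov,
of `x' = B φ(x) - v(t)` with the (discontinuous) feedback `u = φ(x)`. -/
structure IsFilippovSolution {ι : Type*} [Fintype ι] [DecidableEq ι]
    (φ : (Coalition ι → ℝ) → (ι ⊕ ProperCoalition ι → ℝ))
    (v : ℝ → Coalition ι → ℝ) (x : ℝ → Coalition ι → ℝ)
    (u : ℝ → ι ⊕ ProperCoalition ι → ℝ) : Prop where
  integrable : ∀ t, 0 ≤ t → IntervalIntegrable u volume 0 t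
  feedback : ∀ᵐ t ∂(volume.restrict (Set.Ici (0 : ℝ))), u t ∈ filippovSet φ (x t)
  dynamics : ∀ t, 0 ≤ t → x t = x 0 + ∫ τ in (0 : ℝ)..t, ((flowMatrix ι).mulVec (u τ) - v τ)

/-- The allocation part of a control path. -/
def allocation {ι : Type*} [Fintype ι] (u : ℝ → ι ⊕ ProperCoalition ι → ℝ) : ℝ → ι → ℝ :=
  fun t i => u t (Sum.inl i)

/-- The vector of excesses at time `t`, for the allocation path `a`, the value path `v` and the
initial excess `e₀`. -/
def excess {ι : Type*} [Fintype ι] (a : ℝ → ι → ℝ) (v : ℝ → Coalition ι → ℝ)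
    (e₀ : Coalition ι → ℝ) (t : ℝ) : Coalition ι → ℝ :=
  fun S => ∑ i ∈ S.1, cumulative (fun τ => a τ i) t - cumulative (fun τ => v τ S) t + e₀ S

/-- The nonnegative orthant, as a subset of the Euclidean space. -/
def nonnegOrthant (κ : Type*) : Set (EuclideanSpace ℝ κ) := {y | ∀ j, 0 ≤ y j}

end

/-! Because `B B† = I`, the closed loop decouples: each coordinate `y` of the state satisfies `y' =
-δ sign y - w` away from `y = 0`, where `w` is the centred fluctuation of one coalition value. The
size of `w` may exceed `δ`, so the drift need not point to `0` at every instant; it does so only on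
average.

Apply the bounded function `lyap` to `y` and take expectations. The cross term `E[lyap'(y) w]`
vanishes by independence and centring, so `δ ∫ E|lyap'(y)| dt ≤ 1`, and by Fubini almost every path
has integrable `lyap'(y)` (`ae_integrableOn_lyapDeriv_of_measurable`). Boundedness of `lyap` and
`lyap'` makes moments of the state unnecessary.

On such a path `lyap (y t)` converges, since `w` is bounded. A positive limit, escape to infinity
included, would freeze the sign of `y`; then ergodicity gives `y t / t → ∓δ`, against that sign.
Hence `y → 0` (`IsSignFeedbackPath.tendsto_zero`).

Dividing the dynamics by `t`, the feedback averages to zero. Since `u` is `unom` plus `B†` applied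
to the feedback, the average allocation tends to the nominal one, a core point because surpluses are
slacks. Finally the excess is `x` plus the cumulated surplus, which is nonnegative and
nondecreasing. -/

/-! ### Chain rule for absolutely continuous paths -/

/-- Chain rule along an integral: `H` is `C¹` and `y` is an indefinite integral of `g`. -/
theorem sub_eq_integral_comp_of_eq_integral {y g H h : ℝ → ℝ} {T : ℝ} (hT : 0 ≤ T)
    (hg : IntervalIntegrable g volume 0 T)
    (hy : ∀ t, 0 ≤ t → y t = y 0 + ∫ τ in (0 : ℝ)..t, g τ)
    (hH : ∀ z, HasDerivAt H (h z) z) {K : NNReal} (hlip : LipschitzWith K H) :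
    H (y T) - H (y 0) = ∫ t in (0 : ℝ)..T, h (y t) * g t := by
  -- The integral formula for `y` holds only at `t ≥ 0`, so the argument runs on the primitive `Y`,
  -- which agrees with `y` there.
  set Y : ℝ → ℝ := fun t => y 0 + ∫ τ in (0 : ℝ)..t, g τ with hYdef
  have hY : AbsolutelyContinuousOnInterval (fun t => ∫ τ in (0 : ℝ)..t, g τ) 0 T :=
    hg.absolutelyContinuousOnInterval_intervalIntegral (by simp)
  have hHY : AbsolutelyContinuousOnInterval (fun t => H (Y t)) 0 T := by
    rw [absolutelyContinuousOnInterval_iff] at hY ⊢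
    intro ε hε
    -- `K + 1` rather than `K`, since the Lipschitz constant may be zero.
    obtain ⟨d, hd, hd'⟩ := hY (ε / (K + 1)) (by positivity)
    refine ⟨d, hd, fun E hE hlen => ?_⟩
    have h1 := hd' E hE hlen
    calc _ ≤ ∑ i ∈ Finset.range E.1, (K : ℝ) * dist (∫ τ in (0 : ℝ)..(E.2 i).1, g τ)
            (∫ τ in (0 : ℝ)..(E.2 i).2, g τ) := by
          refine Finset.sum_le_sum fun i _ => (hlip.dist_le_mul _ _).trans ?_
          simp [hYdef]
      _ = K * ∑ i ∈ Finset.range E.1, dist (∫ τ in (0 : ℝ)..(E.2 i).1, g τ)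
            (∫ τ in (0 : ℝ)..(E.2 i).2, g τ) := by rw [Finset.mul_sum]
      _ ≤ K * (ε / (K + 1)) := by gcongr
      _ < (K + 1) * (ε / (K + 1)) := by gcongr; linarith
      _ = ε := by field_simp
  have h2 := hHY.integral_deriv_eq_sub
  have e0 : Y 0 = y 0 := by simp [hYdef]
  have eT : Y T = y T := (hy T hT).symm
  rw [← eT, ← e0, ← h2]
  refine intervalIntegral.integral_congr_ae ?_
  filter_upwards [hg.ae_hasDerivAt_integral] with t ht hmem
  have h3 : HasDerivAt Y (g t) t :=
    (ht (Set.uIoc_subset_uIcc hmem) 0 (by simp)).const_add (y 0)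
  have h4 : Y t = y t := by
    rw [Set.uIoc_of_le hT] at hmem
    exact (hy t hmem.1.le).symm
  rw [← h4]
  exact ((hH (Y t)).comp t h3).deriv

/-! ### The bounded Lyapunov function -/

/-- The bounded Lyapunov function `z ^ 2 / (1 + z ^ 2)`. -/
noncomputable def lyap (z : ℝ) : ℝ := 1 - (1 + z ^ 2)⁻¹

/-- The derivative of `lyap`. -/
noncomputable def lyapDeriv (z : ℝ) : ℝ := 2 * z / (1 + z ^ 2) ^ 2

theorem hasDerivAt_lyap (z : ℝ) : HasDerivAt lyap (lyapDeriv z) z := by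
  have h1 : HasDerivAt (fun z : ℝ => 1 + z ^ 2) (2 * z) z := by
    simpa using (hasDerivAt_pow 2 z).const_add 1
  have := (h1.inv (by positivity)).const_sub 1
  convert! this using 1
  unfold lyapDeriv; ring

theorem continuous_lyap : Continuous lyap :=
  continuous_iff_continuousAt.2 fun z => (hasDerivAt_lyap z).continuousAt

theorem continuous_lyapDeriv : Continuous lyapDeriv := by
  unfold lyapDeriv
  exact (by fun_prop : Continuous fun z : ℝ => 2 * z).div (by fun_prop) fun z => by positivity

theorem abs_lyapDeriv_le (z : ℝ) : |lyapDeriv z| ≤ 1 := by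
  unfold lyapDeriv
  rw [abs_div, abs_of_pos (by positivity : (0 : ℝ) < (1 + z ^ 2) ^ 2), div_le_one (by positivity),
    abs_le]
  constructor <;> nlinarith [sq_nonneg (z - 1), sq_nonneg (z + 1), sq_nonneg z, sq_nonneg (z ^ 2)]

theorem lyap_nonneg (z : ℝ) : 0 ≤ lyap z := by
  unfold lyap
  have : (1 + z ^ 2)⁻¹ ≤ 1 := inv_le_one_of_one_le₀ (by nlinarith [sq_nonneg z])
  linarith

theorem lyap_le_one (z : ℝ) : lyap z ≤ 1 := by
  unfold lyap
  have : 0 ≤ (1 + z ^ 2)⁻¹ := by positivity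
  linarith

theorem lipschitzWith_lyap : LipschitzWith 1 lyap := by
  refine lipschitzWith_of_nnnorm_deriv_le (fun z => (hasDerivAt_lyap z).differentiableAt) fun z => ?_
  rw [(hasDerivAt_lyap z).deriv, ← NNReal.coe_le_coe]
  simpa using abs_lyapDeriv_le z

/-- `lyap` increases strictly with `|z|`, so smallness of `lyap (y t)` is smallness of `y t`. -/
theorem lyap_lt_iff {a z : ℝ} (ha : 0 ≤ a) : lyap z < lyap a ↔ |z| < a := by
  unfold lyap
  rw [sub_lt_sub_iff_left, inv_lt_inv₀ (by positivity) (by positivity), add_lt_add_iff_left,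
    sq_lt_sq, abs_of_nonneg ha]

/-! ### Pathwise analysis of scalar sign feedback -/

/-- A scalar path `y' = b - w` where `b` is the Filippov feedback `-δ sign y` and `w` is a bounded
disturbance. -/
structure IsSignFeedbackPath (δ M : ℝ) (y b w : ℝ → ℝ) : Prop where
  integrable : ∀ t, 0 ≤ t → IntervalIntegrable b volume 0 t
  feedback : ∀ᵐ t ∂(volume.restrict (Set.Ici (0 : ℝ))),
    |b t| ≤ δ ∧ (0 < y t → b t = -δ) ∧ (y t < 0 → b t = δ)
  measurable : Measurable w
  bound : ∀ t, 0 ≤ t → |w t| ≤ M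
  dynamics : ∀ t, 0 ≤ t → y t = y 0 + ∫ τ in (0 : ℝ)..t, (b τ - w τ)

namespace IsSignFeedbackPath

variable {δ M : ℝ} {y b w : ℝ → ℝ}

/-- The feedback law is odd; this symmetry reduces negative paths to positive ones. -/
theorem neg (h : IsSignFeedbackPath δ M y b w) :
    IsSignFeedbackPath δ M (fun t => -y t) (fun t => -b t) (fun t => -w t) where
  integrable t ht := (h.integrable t ht).neg
  feedback := by
    filter_upwards [h.feedback] with t ht
    refine ⟨by simpa using ht.1, fun h' => ?_, fun h' => ?_⟩
    · rw [ht.2.2 (by linarith)]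
    · rw [ht.2.1 (by linarith), neg_neg]
  measurable := h.measurable.neg
  bound t ht := by simpa using h.bound t ht
  dynamics t ht := by
    rw [h.dynamics t ht]
    have : ∀ τ, -b τ - -w τ = -(b τ - w τ) := fun τ => by ring
    simp only [this, intervalIntegral.integral_neg]
    ring

theorem intervalIntegrable_disturbance (h : IsSignFeedbackPath δ M y b w) {t : ℝ} (ht : 0 ≤ t) :
    IntervalIntegrable w volume 0 t := by
  rw [intervalIntegrable_iff, Set.uIoc_of_le ht]
  refine Measure.integrableOn_of_bounded (M := M) (by simp) h.measurable.aestronglyMeasurable ?_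
  rw [ae_restrict_iff' measurableSet_Ioc]
  exact ae_of_all _ fun s hs => h.bound s hs.1.le

theorem intervalIntegrable (h : IsSignFeedbackPath δ M y b w) {t : ℝ} (ht : 0 ≤ t) :
    IntervalIntegrable (fun τ => b τ - w τ) volume 0 t :=
  (h.integrable t ht).sub (h.intervalIntegrable_disturbance ht)

theorem continuousOn (h : IsSignFeedbackPath δ M y b w) : ContinuousOn y (Set.Ici 0) := by
  intro t ht
  have ht' : (0 : ℝ) ≤ t + 1 := by linarith [Set.mem_Ici.1 ht]
  have h1 : ContinuousOn (fun s => y 0 + ∫ τ in (0 : ℝ)..s, (b τ - w τ)) (Set.uIcc 0 (t + 1)) :=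
    continuousOn_const.add
      (intervalIntegral.continuousOn_primitive_interval' (h.intervalIntegrable ht') (by simp))
  rw [Set.uIcc_of_le ht'] at h1
  have h2 : ContinuousOn y (Set.Icc 0 (t + 1)) := h1.congr fun s hs => h.dynamics s hs.1
  refine (h2 t ⟨ht, by linarith⟩).mono_of_mem_nhdsWithin ?_
  rw [← Set.Ici_inter_Iic]
  exact Filter.inter_mem self_mem_nhdsWithin
    (mem_nhdsWithin_of_mem_nhds (Iic_mem_nhds (by linarith)))

theorem feedback_interval (h : IsSignFeedbackPath δ M y b w) {t : ℝ} (ht : 0 ≤ t) :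
    ∀ᵐ s, s ∈ Set.uIoc 0 t → |b s| ≤ δ ∧ (0 < y s → b s = -δ) ∧ (y s < 0 → b s = δ) := by
  have := (ae_restrict_iff' measurableSet_Ici).1 h.feedback
  filter_upwards [this] with s hs hmem
  rw [Set.uIoc_of_le ht] at hmem
  exact hs hmem.1.le

/-- The balance of the Lyapunov function along the path. -/
theorem lyap_balance (h : IsSignFeedbackPath δ M y b w) {T : ℝ} (hT : 0 ≤ T) :
    lyap (y T) - lyap (y 0) =
      ∫ t in (0 : ℝ)..T, (-δ * |lyapDeriv (y t)| - lyapDeriv (y t) * w t) := by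
  rw [sub_eq_integral_comp_of_eq_integral hT (h.intervalIntegrable hT) h.dynamics
    hasDerivAt_lyap lipschitzWith_lyap]
  refine intervalIntegral.integral_congr_ae ?_
  filter_upwards [h.feedback_interval hT] with t ht hmem
  obtain ⟨-, hp, hn⟩ := ht hmem
  rw [mul_sub]
  congr 1
  rcases lt_trichotomy (y t) 0 with hy | hy | hy
  · have : lyapDeriv (y t) ≤ 0 := div_nonpos_of_nonpos_of_nonneg (by linarith) (by positivity)
    rw [hn hy, abs_of_nonpos this]; ring
  -- While sliding at `0` the feedback is undetermined, but `lyapDeriv 0 = 0` hides its value.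
  · simp [hy, lyapDeriv]
  · have : 0 ≤ lyapDeriv (y t) := div_nonneg (by linarith) (by positivity)
    rw [hp hy, abs_of_nonneg this]; ring

/-- If the disturbance averages out, the feedback drives a positive path down. -/
theorem not_eventually_pos (h : IsSignFeedbackPath δ M y b w) (hδ : 0 < δ)
    (hw : Tendsto (timeAverage w) atTop (𝓝 0)) : ¬ ∀ᶠ t in atTop, 0 < y t := by
  intro hev
  obtain ⟨T, hT⟩ := eventually_atTop.1 (hev.and (eventually_ge_atTop 0))
  have hT0 : 0 ≤ T := (hT T le_rfl).2
  -- After `T` the feedback is constantly `-δ`, so `y t / t` is `-δ` up to the average of `w` and a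
  -- term of order `1 / t`.
  have key : ∀ t, T ≤ t →
      t⁻¹ * y t = t⁻¹ * (y 0 + (∫ τ in (0 : ℝ)..T, b τ) + δ * T) - δ * (t⁻¹ * t)
        - timeAverage w t := by
    intro t ht
    have ht0 := hT0.trans ht
    have hIT := h.integrable T hT0
    have hIt := h.integrable t ht0
    have e1 : ∫ τ in T..t, b τ = ∫ τ in T..t, (-δ) := by
      refine intervalIntegral.integral_congr_ae ?_
      filter_upwards [h.feedback_interval ht0] with s hs hmem
      rw [Set.uIoc_of_le ht] at hmem
      refine (hs ?_).2.1 (hT s hmem.1.le).1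
      rw [Set.uIoc_of_le ht0]
      exact ⟨hT0.trans_lt hmem.1, hmem.2⟩
    have e2 : ∫ τ in (0 : ℝ)..t, b τ = (∫ τ in (0 : ℝ)..T, b τ) + ∫ τ in T..t, b τ :=
      (intervalIntegral.integral_add_adjacent_intervals hIT (hIT.symm.trans hIt)).symm
    rw [h.dynamics t ht0, intervalIntegral.integral_sub hIt (h.intervalIntegrable_disturbance ht0),
      e2, e1, intervalIntegral.integral_const, timeAverage, cumulative]
    simp only [smul_eq_mul]
    ring
  have lim : Tendsto (fun t => t⁻¹ * y t) atTop (𝓝 (0 * (y 0 + (∫ τ in (0 : ℝ)..T, b τ) + δ * T)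
      - δ * 1 - 0)) := by
    have i1 : Tendsto (fun t : ℝ => t⁻¹ * t) atTop (𝓝 1) := by
      refine tendsto_const_nhds.congr' ?_
      filter_upwards [eventually_gt_atTop 0] with t ht
      field_simp
    refine (((tendsto_inv_atTop_zero.mul_const _).sub (i1.const_mul δ)).sub hw).congr' ?_
    filter_upwards [eventually_ge_atTop T] with t ht
    exact (key t ht).symm
  have : (0 : ℝ) ≤ 0 * (y 0 + (∫ τ in (0 : ℝ)..T, b τ) + δ * T) - δ * 1 - 0 := by
    refine ge_of_tendsto lim ?_
    filter_upwards [eventually_ge_atTop T] with t ht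
    exact mul_nonneg (inv_nonneg.2 (hT t ht).2) (hT t ht).1.le
  linarith

/-- A path whose Lyapunov function has an integrable dissipation converges to `0`. -/
theorem tendsto_zero (h : IsSignFeedbackPath δ M y b w) (hδ : 0 < δ)
    (hw : Tendsto (timeAverage w) atTop (𝓝 0))
    (hint : IntegrableOn (fun t => lyapDeriv (y t)) (Set.Ioi 0)) :
    Tendsto y atTop (𝓝 0) := by
  have hF : IntegrableOn (fun t => -δ * |lyapDeriv (y t)| - lyapDeriv (y t) * w t) (Set.Ioi 0) := by
    refine (hint.abs.const_mul (-δ)).sub (Integrable.mul_bdd (c := M) hint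
      h.measurable.aestronglyMeasurable ?_)
    rw [ae_restrict_iff' measurableSet_Ioi]
    exact ae_of_all _ fun s hs => h.bound s (Set.mem_Ioi.1 hs).le
  obtain ⟨L, hL⟩ : ∃ L, Tendsto (fun t => lyap (y t)) atTop (𝓝 L) := by
    refine ⟨_, ((intervalIntegral_tendsto_integral_Ioi 0 hF tendsto_id).const_add
      (lyap (y 0))).congr' ?_⟩
    filter_upwards [eventually_ge_atTop 0] with t ht
    have := h.lyap_balance ht
    simp only [id]
    linarith
  have hL0 : 0 ≤ L := ge_of_tendsto' hL fun t => lyap_nonneg _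
  rcases hL0.eq_or_lt with rfl | hpos
  · rw [Metric.tendsto_atTop']
    intro ε hε
    have hlε : 0 < lyap ε := by
      have := (lyap_lt_iff (z := 0) hε.le).2 (by simpa using hε)
      exact (lyap_nonneg 0).trans_lt this
    obtain ⟨N, hN⟩ := eventually_atTop.1 (hL.eventually_lt_const hlε)
    exact ⟨N, fun t ht => by simpa using (lyap_lt_iff hε.le).1 (hN t ht.le)⟩
  -- Integrable dissipation alone does not exclude this case, because `lyapDeriv` decays at
  -- infinity. Here `y` is eventually nonzero, hence of constant sign by connectedness.
  · exfalso
    obtain ⟨T, hT⟩ := eventually_atTop.1 ((hL.eventually_const_lt hpos).and (eventually_ge_atTop 0))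
    have hne : ∀ t, T ≤ t → y t ≠ 0 := fun t ht h0 => by
      have := (hT t ht).1
      simp [h0, lyap] at this
    have hc : ContinuousOn y (Set.Ici T) :=
      h.continuousOn.mono (Set.Ici_subset_Ici.2 (hT T le_rfl).2)
    have hpre := isPreconnected_Ici.image y hc
    by_cases hsig : 0 < y T
    · refine h.not_eventually_pos hδ hw (eventually_atTop.2 ⟨T, fun t ht => ?_⟩)
      by_contra hcon
      obtain ⟨s, hs, hs0⟩ := hpre.Icc_subset ⟨t, ht, rfl⟩ ⟨T, Set.self_mem_Ici, rfl⟩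
        ⟨not_lt.1 hcon, hsig.le⟩
      exact hne s hs hs0
    · have hw' : Tendsto (timeAverage fun t => -w t) atTop (𝓝 0) := by
        have e : (timeAverage fun t => -w t) = fun t => -timeAverage w t := by
          ext t; simp [timeAverage, cumulative]
        rw [e]; simpa using hw.neg
      refine h.neg.not_eventually_pos hδ hw' (eventually_atTop.2 ⟨T, fun t ht => ?_⟩)
      by_contra hcon
      obtain ⟨s, hs, hs0⟩ := hpre.Icc_subset ⟨T, Set.self_mem_Ici, rfl⟩ ⟨t, ht, rfl⟩
        ⟨not_lt.1 hsig, by linarith⟩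
      exact hne s hs hs0

end IsSignFeedbackPath

/-! ### Expected dissipation and almost sure convergence -/

/-- If the disturbance is centred and independent of the state, the expected dissipation of the
Lyapunov function is finite, so that almost every path has an integrable dissipation. -/
theorem ae_integrableOn_lyapDeriv_of_measurable {Ω : Type*} [MeasurableSpace Ω] {μ : Measure Ω}
    [IsProbabilityMeasure μ] {δ M : ℝ} (hδ : 0 < δ) {y w : ℝ → Ω → ℝ}
    (hy : Measurable (Function.uncurry y)) (hw : Measurable (Function.uncurry w))
    (hM : ∀ t ω, |w t ω| ≤ M) (hindep : ∀ t, 0 ≤ t → IndepFun (y t) (w t) μ)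
    (hmean : ∀ t, 0 ≤ t → ∫ ω, w t ω ∂μ = 0)
    (hbal : ∀ᵐ ω ∂μ, ∀ T, 0 ≤ T → lyap (y T ω) - lyap (y 0 ω) =
      ∫ t in (0 : ℝ)..T, (-δ * |lyapDeriv (y t ω)| - lyapDeriv (y t ω) * w t ω)) :
    ∀ᵐ ω ∂μ, IntegrableOn (fun t => lyapDeriv (y t ω)) (Set.Ioi 0) := by
  have hym : ∀ t, Measurable (y t) := fun t => hy.comp measurable_prodMk_left
  have hwm : ∀ t, Measurable (w t) := fun t => hw.comp measurable_prodMk_left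
  have hD : Measurable (fun p : ℝ × Ω => lyapDeriv (y p.1 p.2)) :=
    continuous_lyapDeriv.measurable.comp hy
  have hfin : ∀ T : ℝ, IsFiniteMeasure (volume.restrict (Set.uIoc 0 T)) := fun T =>
    ⟨by simp [Set.uIoc]⟩
  have hDint : ∀ T : ℝ, Integrable (fun p : ℝ × Ω => lyapDeriv (y p.1 p.2))
      ((volume.restrict (Set.uIoc 0 T)).prod μ) := fun T =>
    Integrable.of_bound hD.aestronglyMeasurable 1 (ae_of_all _ fun p => abs_lyapDeriv_le _)
  have hDwint : ∀ T : ℝ, Integrable (fun p : ℝ × Ω => lyapDeriv (y p.1 p.2) * w p.1 p.2)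
      ((volume.restrict (Set.uIoc 0 T)).prod μ) := fun T =>
    (hDint T).mul_bdd (c := M) hw.aestronglyMeasurable (ae_of_all _ fun p => hM _ _)
  have hzero : ∀ t, 0 ≤ t → ∫ ω, lyapDeriv (y t ω) * w t ω ∂μ = 0 := fun t ht => by
    have := ((hindep t ht).comp continuous_lyapDeriv.measurable
      measurable_id).integral_fun_mul_eq_mul_integral
      (continuous_lyapDeriv.measurable.comp (hym t)).aestronglyMeasurable
      (hwm t).aestronglyMeasurable
    simpa [hmean t ht] using this
  -- The bound is uniform in `T`: `lyap` takes values in `[0, 1]`, so its expectation drops by at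
  -- most `1`, and the cross term is zero by `hzero`.
  have hexp : ∀ T, 0 ≤ T → ∫ t in (0 : ℝ)..T, ∫ ω, |lyapDeriv (y t ω)| ∂μ ≤ δ⁻¹ := by
    intro T hT
    have i1 : Integrable (fun ω => lyap (y T ω) - lyap (y 0 ω)) μ := by
      refine Integrable.of_bound (((continuous_lyap.measurable.comp (hym T)).sub
        (continuous_lyap.measurable.comp (hym 0))).aestronglyMeasurable) 1 (ae_of_all _ fun ω => ?_)
      rw [Real.norm_eq_abs, abs_le]
      constructor <;> linarith [lyap_nonneg (y T ω), lyap_nonneg (y 0 ω), lyap_le_one (y T ω),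
        lyap_le_one (y 0 ω)]
    have i2 : (-1 : ℝ) ≤ ∫ ω, (lyap (y T ω) - lyap (y 0 ω)) ∂μ := by
      have : ∫ _ : Ω, (-1 : ℝ) ∂μ ≤ ∫ ω, (lyap (y T ω) - lyap (y 0 ω)) ∂μ :=
        integral_mono (integrable_const _) i1 fun ω => by
          linarith [lyap_nonneg (y T ω), lyap_le_one (y 0 ω)]
      simpa using this
    have i3 : ∫ ω, (lyap (y T ω) - lyap (y 0 ω)) ∂μ =
        -δ * ∫ t in (0 : ℝ)..T, ∫ ω, |lyapDeriv (y t ω)| ∂μ := by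
      rw [integral_congr_ae (hbal.mono fun ω h => h T hT),
        ← intervalIntegral_integral_swap (((hDint T).abs.const_mul (-δ)).sub (hDwint T)),
        ← intervalIntegral.integral_const_mul]
      refine intervalIntegral.integral_congr fun t ht => ?_
      rw [Set.uIcc_of_le hT] at ht
      have j1 : Integrable (fun ω => lyapDeriv (y t ω)) μ :=
        Integrable.of_bound (continuous_lyapDeriv.measurable.comp (hym t)).aestronglyMeasurable 1
          (ae_of_all _ fun ω => abs_lyapDeriv_le _)
      have j2 : Integrable (fun ω => lyapDeriv (y t ω) * w t ω) μ :=
        j1.mul_bdd (c := M) (hwm t).aestronglyMeasurable (ae_of_all _ fun ω => hM _ _)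
      rw [integral_sub (j1.abs.const_mul _) j2, hzero t ht.1, integral_const_mul, sub_zero]
    rw [i3] at i2
    rw [← one_div, le_div_iff₀ hδ]
    linarith
  have hφ : IntegrableOn (fun t => ∫ ω, ‖lyapDeriv (y t ω)‖ ∂μ) (Set.Ioi 0) := by
    refine integrableOn_Ioi_of_intervalIntegral_norm_bounded (l := atTop) (b := fun n : ℕ => (n : ℝ))
      δ⁻¹ 0 (fun n => ?_) tendsto_natCast_atTop_atTop (Eventually.of_forall fun n => ?_)
    · have := (hDint n).norm.integral_prod_left
      rwa [Set.uIoc_of_le n.cast_nonneg] at this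
    · refine le_trans (le_of_eq ?_) (hexp n n.cast_nonneg)
      refine intervalIntegral.integral_congr fun t _ => ?_
      simp only [Real.norm_eq_abs]
      exact abs_of_nonneg (integral_nonneg fun ω => abs_nonneg _)
  -- Tonelli on time and probability; the time sections of the result are the paths.
  have htot : Integrable (fun p : ℝ × Ω => lyapDeriv (y p.1 p.2))
      ((volume.restrict (Set.Ioi 0)).prod μ) := by
    rw [integrable_prod_iff hD.aestronglyMeasurable]
    refine ⟨ae_of_all _ fun t => ?_, hφ⟩
    exact Integrable.of_bound (continuous_lyapDeriv.measurable.comp (hym t)).aestronglyMeasurable 1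
      (ae_of_all _ fun ω => abs_lyapDeriv_le _)
  exact htot.prod_left_ae

/-- Stochastic convergence of sign feedback paths: the disturbance is bounded, centred, independent
of the state at each time, and averages out. -/
theorem ae_tendsto_zero_of_isSignFeedbackPath {Ω : Type*} [MeasurableSpace Ω] {μ : Measure Ω}
    [IsProbabilityMeasure μ] {δ M : ℝ} (hδ : 0 < δ) {y b w : ℝ → Ω → ℝ}
    (hpath : ∀ᵐ ω ∂μ, IsSignFeedbackPath δ M (fun t => y t ω) (fun t => b t ω) (fun t => w t ω))
    (hy : ∀ t, 0 ≤ t → Measurable (y t)) (hw : Measurable (Function.uncurry w))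
    (hindep : ∀ t, 0 ≤ t → IndepFun (y t) (w t) μ)
    (hmean : ∀ t, 0 ≤ t → ∫ ω, w t ω ∂μ = 0)
    (hlim : ∀ᵐ ω ∂μ, Tendsto (timeAverage fun t => w t ω) atTop (𝓝 0)) :
    ∀ᵐ ω ∂μ, Tendsto (fun t => y t ω) atTop (𝓝 0) := by
  -- The bad event need not be measurable, so it is replaced by its measurable hull, still null.
  -- Below, the processes are set to zero on `N` and frozen at negative times, where nothing is
  -- assumed.
  set N : Set Ω := toMeasurable μ
    {ω | ¬ IsSignFeedbackPath δ M (fun t => y t ω) (fun t => b t ω) (fun t => w t ω)} with hN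
  have hNm : MeasurableSet N := measurableSet_toMeasurable _ _
  have hN0 : ∀ᵐ ω ∂μ, ω ∉ N := by
    rw [ae_iff]
    simpa [hN, measure_toMeasurable] using ae_iff.1 hpath
  have hgood : ∀ ω, ω ∉ N →
      IsSignFeedbackPath δ M (fun t => y t ω) (fun t => b t ω) (fun t => w t ω) := fun ω hω => by
    by_contra hcon
    exact hω (subset_toMeasurable _ _ hcon)
  -- Only each `y t` is known to be measurable; continuity of the modified paths upgrades this to
  -- joint measurability.
  have hy' : Measurable (Function.uncurry fun t => Nᶜ.indicator (y (max t 0))) := by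
    refine measurable_uncurry_of_continuous_of_measurable (fun ω => ?_) fun t =>
      (hy _ (le_max_right _ _)).indicator hNm.compl
    by_cases hω : ω ∈ N
    · simpa [hω] using continuous_const
    · have : Continuous fun t : ℝ => y (max t 0) ω :=
        (hgood ω hω).continuousOn.comp_continuous (f := fun t : ℝ => max t 0) (by fun_prop)
          fun t => Set.mem_Ici.2 (le_max_right t 0)
      simpa [hω] using this
  have hw' : Measurable (Function.uncurry fun t => Nᶜ.indicator (w (max t 0))) := by
    have h1 : Measurable fun p : ℝ × Ω => w (max p.1 0) p.2 :=
      hw.comp (((measurable_fst.max measurable_const)).prodMk measurable_snd)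
    have h2 := h1.indicator (measurable_snd hNm.compl)
    convert! h2 using 1
  have hae : ∀ (f : ℝ → Ω → ℝ) t, 0 ≤ t → f t =ᵐ[μ] Nᶜ.indicator (f (max t 0)) := by
    intro f t ht
    filter_upwards [hN0] with ω hω
    simp [hω, ht]
  -- `|M|` because the bound must also hold for the zero values on `N`, while the sign of `M` is
  -- unknown.
  have hint := ae_integrableOn_lyapDeriv_of_measurable (μ := μ) (M := |M|) hδ hy' hw'
    (fun t ω => by
      by_cases hω : ω ∈ N
      · simp [hω]
      · simpa [hω] using ((hgood ω hω).bound _ (le_max_right t 0)).trans (le_abs_self M))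
    (fun t ht => (hindep t ht).congr (hae y t ht) (hae w t ht))
    (fun t ht => by rw [← integral_congr_ae (hae w t ht), hmean t ht])
    (by
      filter_upwards [hN0] with ω hω T hT
      have := (hgood ω hω).lyap_balance hT
      simp only [Set.mem_compl_iff, hω, not_false_eq_true, Set.indicator_of_mem, max_eq_left hT,
        max_self]
      rw [this]
      refine intervalIntegral.integral_congr fun t ht => ?_
      rw [Set.uIcc_of_le hT] at ht
      simp only [max_eq_left ht.1])
  filter_upwards [hint, hN0, hlim] with ω hi hω hl
  refine (hgood ω hω).tendsto_zero hδ hl ?_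
  refine hi.congr_fun (fun t ht => ?_) measurableSet_Ioi
  simp [hω, max_eq_left (Set.mem_Ioi.1 ht).le]

/-! ### Filippov set of the sign controller -/

/-- The Filippov set at `x` lies in every closed convex set that contains the values of the map
near `x`. -/
theorem filippovSet_subset {E F : Type*} [PseudoMetricSpace E] [MeasureSpace E]
    [NormedAddCommGroup F] [NormedSpace ℝ F] {g : E → F} {x : E} {C : Set F}
    (hC : IsClosed C) (hconv : Convex ℝ C) {r : ℝ} (hr : 0 < r)
    (h : ∀ y ∈ Metric.ball x r, g y ∈ C) : filippovSet g x ⊆ C := by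
  intro z hz
  simp only [filippovSet, Set.mem_iInter] at hz
  refine closure_minimal (convexHull_min ?_ hconv) hC (hz r hr ∅ measure_empty)
  rintro _ ⟨y, hy, rfl⟩
  exact h y hy.1

theorem flowMatrix_mulVec_apply {ι : Type*} [Fintype ι] [DecidableEq ι]
    (u : ι ⊕ ProperCoalition ι → ℝ) (S : Coalition ι) :
    (flowMatrix ι).mulVec u S = ∑ i ∈ S.1, u (Sum.inl i) -
      if h : S.1 ≠ Finset.univ then u (Sum.inr ⟨S.1, S.2, h⟩) else 0 := by
  rw [flowMatrix, Matrix.fromCols_mulVec, Pi.add_apply, sub_eq_add_neg]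
  congr 1
  · simp [incidenceMatrix, Matrix.mulVec, dotProduct]
  · simp only [surplusMatrix, Matrix.mulVec, dotProduct, Matrix.of_apply, ite_mul, zero_mul,
      neg_mul, one_mul, Function.comp_apply]
    split_ifs with h
    · rw [Finset.sum_eq_single ⟨S.1, S.2, h⟩]
      · simp
      · intro T _ hT
        rw [if_neg fun h' => hT (Subtype.ext h')]
      · simp
    · rw [neg_zero]
      refine Finset.sum_eq_zero fun T _ => if_neg fun h' => T.2.2 ?_
      rw [h', not_not.1 h]

theorem flowMatrix_mulVec_signController {ι : Type*} [Fintype ι] [DecidableEq ι]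
    {unom : ι ⊕ ProperCoalition ι → ℝ} {δ : ℝ}
    {Bdag : Matrix (ι ⊕ ProperCoalition ι) (Coalition ι) ℝ} (hBdag : flowMatrix ι * Bdag = 1)
    (σ : Coalition ι → ℝ) :
    (flowMatrix ι).mulVec (signController unom δ Bdag σ) =
      (flowMatrix ι).mulVec unom - δ • σ := by
  rw [signController, Matrix.mulVec_sub, Matrix.mulVec_smul, Matrix.mulVec_mulVec, hBdag,
    Matrix.one_mulVec]

section Feedback

variable {ι : Type*} [Fintype ι] [DecidableEq ι]
  {unom : ι ⊕ ProperCoalition ι → ℝ} {δ : ℝ}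
  {Bdag : Matrix (ι ⊕ ProperCoalition ι) (Coalition ι) ℝ}
  {x : Coalition ι → ℝ} {u : ι ⊕ ProperCoalition ι → ℝ}

/-- Applying `B` to the controller leaves `-δ sgn` in each coordinate, because `B B† = I`. Intervals
are closed and convex, so the coordinate bounds pass to the convexification. -/
theorem flow_component_of_mem_filippovSet (hBdag : flowMatrix ι * Bdag = 1) (hδ : 0 ≤ δ)
    (hu : u ∈ filippovSet (fun y => signController unom δ Bdag (sgn y)) x) (S : Coalition ι) :
    |(flowMatrix ι).mulVec u S - (flowMatrix ι).mulVec unom S| ≤ δ ∧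
    (0 < x S → (flowMatrix ι).mulVec u S - (flowMatrix ι).mulVec unom S = -δ) ∧
    (x S < 0 → (flowMatrix ι).mulVec u S - (flowMatrix ι).mulVec unom S = δ) := by
  set L : (ι ⊕ ProperCoalition ι → ℝ) →ₗ[ℝ] ℝ :=
    (LinearMap.proj S).comp (Matrix.mulVecLin (flowMatrix ι)) with hL
  have hLa : ∀ z, (flowMatrix ι).mulVec z S = L z := fun z => rfl
  have hLc : Continuous L := L.continuous_of_finiteDimensional
  have hval : ∀ y : Coalition ι → ℝ, L (signController unom δ Bdag (sgn y)) =
      L unom - δ * Real.sign (y S) := fun y => by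
    rw [← hLa, flowMatrix_mulVec_signController hBdag]
    simp [sgn, hLa]
  have hcoord : ∀ y : Coalition ι → ℝ, |y S - x S| ≤ dist y x := fun y =>
    dist_le_pi_dist y x S
  have key : ∀ (a c r : ℝ), 0 < r → (∀ y ∈ Metric.ball x r,
      L (signController unom δ Bdag (sgn y)) ∈ Set.Icc a c) → L u ∈ Set.Icc a c := by
    intro a c r hr h
    exact filippovSet_subset (C := L ⁻¹' Set.Icc a c) (isClosed_Icc.preimage hLc)
      ((convex_Icc a c).linear_preimage L) hr h hu
  simp only [hLa]
  refine ⟨?_, fun hpos => ?_, fun hneg => ?_⟩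
  · have := key (L unom - δ) (L unom + δ) 1 one_pos fun y _ => by
      rw [hval]
      rcases Real.sign_apply_eq (y S) with h | h | h <;> rw [h] <;> constructor <;> linarith
    rw [abs_le]
    constructor <;> linarith [this.1, this.2]
  -- On the sup-norm ball of radius `x S` the coordinate `S` stays positive, so the interval shrinks
  -- to a point.
  · have := key (L unom - δ) (L unom - δ) (x S) hpos fun y hy => by
      rw [hval, Real.sign_of_pos (by linarith [abs_lt.1 ((hcoord y).trans_lt hy)]), mul_one]
      exact ⟨le_rfl, le_rfl⟩
    linarith [this.1, this.2]
  · have := key (L unom + δ) (L unom + δ) (-x S) (by linarith) fun y hy => by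
      rw [hval, Real.sign_of_neg (by linarith [abs_lt.1 ((hcoord y).trans_lt hy)])]
      constructor <;> linarith
    linarith [this.1, this.2]

/-- Controller values lie in the affine space `unom + range B†`, on which `I - B† B` is constant.
That level set is closed and convex, so it contains the Filippov set as well. -/
theorem eq_add_mulVec_of_mem_filippovSet (hBdag : flowMatrix ι * Bdag = 1)
    (hu : u ∈ filippovSet (fun y => signController unom δ Bdag (sgn y)) x) :
    u = unom + Bdag.mulVec ((flowMatrix ι).mulVec u - (flowMatrix ι).mulVec unom) := by
  set L : (ι ⊕ ProperCoalition ι → ℝ) →ₗ[ℝ] (ι ⊕ ProperCoalition ι → ℝ) :=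
    LinearMap.id - (Matrix.mulVecLin Bdag).comp (Matrix.mulVecLin (flowMatrix ι)) with hL
  have hLa : ∀ z, L z = z - Bdag.mulVec ((flowMatrix ι).mulVec z) := fun z => rfl
  have : u ∈ L ⁻¹' {L unom} := by
    refine filippovSet_subset (isClosed_singleton.preimage L.continuous_of_finiteDimensional)
      ((convex_singleton _).linear_preimage L) one_pos (fun y _ => ?_) hu
    rw [Set.mem_preimage, Set.mem_singleton_iff, hLa, hLa,
      flowMatrix_mulVec_signController hBdag, signController, Matrix.mulVec_sub,
      Matrix.mulVec_smul]
    abel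
  rw [Set.mem_preimage, Set.mem_singleton_iff, hLa, hLa, sub_eq_iff_eq_add] at this
  rw [Matrix.mulVec_sub]
  nth_rewrite 1 [this]
  abel

theorem surplus_nonneg_of_mem_filippovSet {aMin aMax : ι → ℝ}
    (hU : ∀ y : Coalition ι → ℝ, signController unom δ Bdag (sgn y) ∈ feasibleControls aMin aMax)
    (hu : u ∈ filippovSet (fun y => signController unom δ Bdag (sgn y)) x)
    (T : ProperCoalition ι) : 0 ≤ u (Sum.inr T) := by
  have hC : IsClosed {z : ι ⊕ ProperCoalition ι → ℝ | 0 ≤ z (Sum.inr T)} :=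
    isClosed_le continuous_const (continuous_apply _)
  have hconv : Convex ℝ {z : ι ⊕ ProperCoalition ι → ℝ | 0 ≤ z (Sum.inr T)} :=
    (convex_Ici (0 : ℝ)).linear_preimage
      (LinearMap.proj (R := ℝ) (φ := fun _ : ι ⊕ ProperCoalition ι => ℝ) (Sum.inr T))
  exact filippovSet_subset hC hconv one_pos (fun y _ => (hU y).2 T) hu

/-- The surplus variables are the slacks of the core inequalities, and the grand coalition has none.
-/
theorem mem_core_of_feasible [Nonempty ι] {aMin aMax : ι → ℝ}
    (hU : unom ∈ feasibleControls aMin aMax) :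
    (fun i => unom (Sum.inl i)) ∈ core ((flowMatrix ι).mulVec unom) := by
  refine ⟨?_, fun S => ?_⟩
  · rw [flowMatrix_mulVec_apply]
    simp [grandCoalition]
  · rw [flowMatrix_mulVec_apply]
    split_ifs with h
    · linarith [hU.2 ⟨S.1, S.2, h⟩]
    · simp

end Feedback

/-! ### Time averages and limits of excess-type paths -/

section Averages

variable {κ : Type*} [Fintype κ]

theorem cumulative_apply {f : ℝ → κ → ℝ} {t : ℝ} (hf : IntervalIntegrable f volume 0 t) (j : κ) :
    cumulative f t j = cumulative (fun τ => f τ j) t :=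
  ((ContinuousLinearMap.proj (R := ℝ) (φ := fun _ : κ => ℝ) j).intervalIntegral_comp_comm hf).symm

theorem IntervalIntegrable.apply {f : ℝ → κ → ℝ} {a b : ℝ} (hf : IntervalIntegrable f volume a b)
    (j : κ) : IntervalIntegrable (fun τ => f τ j) volume a b :=
  ⟨hf.1.eval j, hf.2.eval j⟩

theorem timeAverage_sub_const_tendsto_zero {f : ℝ → ℝ} {c : ℝ}
    (hf : ∀ t, 0 ≤ t → IntervalIntegrable f volume 0 t)
    (h : Tendsto (timeAverage f) atTop (𝓝 c)) :
    Tendsto (timeAverage fun t => f t - c) atTop (𝓝 0) := by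
  have h' := h.sub_const c
  rw [sub_self] at h'
  refine h'.congr' ?_
  filter_upwards [eventually_gt_atTop 0] with t ht
  simp only [timeAverage, cumulative, smul_eq_mul]
  rw [intervalIntegral.integral_sub (hf t ht.le) intervalIntegrable_const,
    intervalIntegral.integral_const]
  simp only [smul_eq_mul]
  field_simp
  ring

theorem IsSignFeedbackPath.timeAverage_feedback_tendsto_zero {δ M : ℝ} {y b w : ℝ → ℝ}
    (h : IsSignFeedbackPath δ M y b w) (hw : Tendsto (timeAverage w) atTop (𝓝 0))
    (hy : Tendsto y atTop (𝓝 0)) : Tendsto (timeAverage b) atTop (𝓝 0) := by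
  have h1 : Tendsto (fun t => t⁻¹ * (y t - y 0) + timeAverage w t) atTop (𝓝 (0 * (0 - y 0) + 0)) :=
    (tendsto_inv_atTop_zero.mul (hy.sub_const _)).add hw
  rw [zero_mul, zero_add] at h1
  refine h1.congr' ?_
  filter_upwards [eventually_ge_atTop 0] with t ht
  rw [h.dynamics t ht, intervalIntegral.integral_sub (h.integrable t ht)
    (h.intervalIntegrable_disturbance ht)]
  simp only [timeAverage, cumulative, smul_eq_mul]
  ring

/-- A vector path that is the sum of a vanishing term and of a nonnegative nondecreasing one
converges to the nonnegative orthant, and its components have limits in `[0, ∞]`. -/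
theorem tendsto_nonnegOrthant_of_eq_add {e x p : ℝ → κ → ℝ}
    (he : ∀ t, 0 ≤ t → e t = x t + p t) (hx : Tendsto x atTop (𝓝 0))
    (hp : ∀ j, MonotoneOn (fun t => p t j) (Set.Ici 0)) (hp0 : p 0 = 0) :
    Tendsto (fun t => Metric.infDist (WithLp.toLp 2 (e t)) (nonnegOrthant κ)) atTop (𝓝 0) ∧
      ∀ j, ∃ l : EReal, 0 ≤ l ∧ Tendsto (fun t => (e t j : EReal)) atTop (𝓝 l) := by
  have hpos : ∀ t, 0 ≤ t → ∀ j, 0 ≤ p t j := fun t ht j => by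
    have := hp j Set.self_mem_Ici ht ht
    simpa [hp0] using this
  constructor
  · have hx' : Tendsto (fun t => ‖WithLp.toLp 2 (x t)‖) atTop (𝓝 0) := by
      have := ((PiLp.continuous_toLp 2 (fun _ : κ => ℝ)).norm.tendsto 0).comp hx
      simpa [Function.comp_def] using this
    refine squeeze_zero' (Eventually.of_forall fun t => Metric.infDist_nonneg) ?_ hx'
    filter_upwards [eventually_ge_atTop 0] with t ht
    have hmem : WithLp.toLp 2 (p t) ∈ nonnegOrthant κ := fun j => hpos t ht j
    refine (Metric.infDist_le_dist_of_mem hmem).trans_eq ?_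
    rw [dist_eq_norm, he t ht, WithLp.toLp_add, add_sub_cancel_right]
  · intro j
    have hxj : Tendsto (fun t => x t j) atTop (𝓝 0) := by
      simpa using (tendsto_pi_nhds.1 hx) j
    have hmono : Monotone fun t => p (max t 0) j := fun s t hst =>
      hp j (le_max_right s 0) (le_max_right t 0) (max_le_max_right 0 hst)
    have hev : (fun t => e t j) =ᶠ[atTop] fun t => x t j + p (max t 0) j := by
      filter_upwards [eventually_ge_atTop 0] with t ht
      rw [he t ht, max_eq_left ht]; rfl
    -- A nondecreasing component either diverges to `⊤` or has a finite limit; the vanishing term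
    -- changes neither.
    rcases tendsto_atTop_of_monotone hmono with h | ⟨l, hl⟩
    · refine ⟨⊤, le_top, EReal.tendsto_coe_nhds_top_iff.2 ?_⟩
      exact (hxj.add_atTop h).congr' hev.symm
    · refine ⟨l, ?_, (continuous_coe_real_ereal.tendsto l).comp ?_⟩
      · exact_mod_cast ge_of_tendsto' hl fun t => hpos _ (le_max_right _ _) j
      · have := (hxj.add hl).congr' hev.symm
        rwa [zero_add] at this

end Averages

/-! ### The closed loop: allocations and excesses -/

section ClosedLoop

variable {ι : Type*} [Fintype ι] [DecidableEq ι]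
  {unom : ι ⊕ ProperCoalition ι → ℝ} {δ M : ℝ}
  {Bdag : Matrix (ι ⊕ ProperCoalition ι) (Coalition ι) ℝ}
  {v x : ℝ → Coalition ι → ℝ} {u : ℝ → ι ⊕ ProperCoalition ι → ℝ}

theorem intervalIntegrable_finsetSum {α : Type*} (s : Finset α) {f : α → ℝ → ℝ} {a b : ℝ}
    (hf : ∀ i ∈ s, IntervalIntegrable (f i) volume a b) :
    IntervalIntegrable (fun τ => ∑ i ∈ s, f i τ) volume a b := by
  simpa only [Finset.sum_fn] using IntervalIntegrable.sum s hf

theorem intervalIntegrable_of_measurable_of_norm_le {κ : Type*} [Fintype κ] {f : ℝ → κ → ℝ}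
    (hf : Measurable f) {C : ℝ} (hC : ∀ t, 0 ≤ t → ‖f t‖ ≤ C) {t : ℝ} (ht : 0 ≤ t) :
    IntervalIntegrable f volume 0 t := by
  rw [intervalIntegrable_iff, Set.uIoc_of_le ht]
  refine Measure.integrableOn_of_bounded (M := C) (by simp) hf.aestronglyMeasurable ?_
  rw [ae_restrict_iff' measurableSet_Ioc]
  exact ae_of_all _ fun s hs => hC s hs.1.le

/-- The cumulated surplus of a coalition, with value `0` for the grand coalition. -/
noncomputable def cumulativeSurplus (u : ℝ → ι ⊕ ProperCoalition ι → ℝ) (t : ℝ)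
    (S : Coalition ι) : ℝ :=
  cumulative (fun τ => if h : S.1 ≠ Finset.univ then u τ (Sum.inr ⟨S.1, S.2, h⟩) else 0) t

namespace IsFilippovSolution

theorem intervalIntegrable_flow {φ : (Coalition ι → ℝ) → (ι ⊕ ProperCoalition ι → ℝ)}
    (h : IsFilippovSolution φ v x u) {t : ℝ} (ht : 0 ≤ t) :
    IntervalIntegrable (fun τ => (flowMatrix ι).mulVec (u τ)) volume 0 t :=
  let L := LinearMap.toContinuousLinearMap (Matrix.mulVecLin (flowMatrix ι))
  ⟨L.integrable_comp (h.integrable t ht).1, L.integrable_comp (h.integrable t ht).2⟩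

theorem dynamics_apply {φ : (Coalition ι → ℝ) → (ι ⊕ ProperCoalition ι → ℝ)}
    (h : IsFilippovSolution φ v x u) (hv : ∀ t, 0 ≤ t → IntervalIntegrable v volume 0 t)
    {t : ℝ} (ht : 0 ≤ t) (S : Coalition ι) :
    x t S = x 0 S + ∫ τ in (0 : ℝ)..t, ((flowMatrix ι).mulVec (u τ) S - v τ S) := by
  rw [h.dynamics t ht, Pi.add_apply]
  congr 1
  exact cumulative_apply ((h.intervalIntegrable_flow ht).sub (hv t ht)) S

/-- Each coordinate of the closed loop is a scalar path with sign feedback. -/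
theorem isSignFeedbackPath
    (h : IsFilippovSolution (fun y => signController unom δ Bdag (sgn y)) v x u)
    (hBdag : flowMatrix ι * Bdag = 1) (hδ : 0 ≤ δ) (hvm : Measurable v)
    (hM : ∀ t, 0 ≤ t → ‖v t‖ ≤ M) (S : Coalition ι) :
    IsSignFeedbackPath δ (M + |(flowMatrix ι).mulVec unom S|) (fun t => x t S)
      (fun t => (flowMatrix ι).mulVec (u t) S - (flowMatrix ι).mulVec unom S)
      (fun t => v t S - (flowMatrix ι).mulVec unom S) where
  integrable t ht := ((h.intervalIntegrable_flow ht).apply S).sub intervalIntegrable_const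
  feedback := h.feedback.mono fun t ht => flow_component_of_mem_filippovSet hBdag hδ ht S
  measurable := ((measurable_pi_apply S).comp hvm).sub_const _
  bound t ht := (abs_sub _ _).trans (by
    gcongr
    exact (norm_le_pi_norm (v t) S).trans (hM t ht))
  dynamics t ht := by
    simp only [sub_sub_sub_cancel_right]
    exact h.dynamics_apply
      (fun t ht => intervalIntegrable_of_measurable_of_norm_le hvm hM ht) ht S

/-- The feedback that averages out leaves the nominal allocation. -/
theorem tendsto_timeAverage_allocation
    (h : IsFilippovSolution (fun y => signController unom δ Bdag (sgn y)) v x u)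
    (hBdag : flowMatrix ι * Bdag = 1)
    (hb : ∀ S, Tendsto (timeAverage fun t =>
      (flowMatrix ι).mulVec (u t) S - (flowMatrix ι).mulVec unom S) atTop (𝓝 0)) :
    Tendsto (timeAverage (allocation u)) atTop (𝓝 fun i => unom (Sum.inl i)) := by
  rw [tendsto_pi_nhds]
  intro i
  have hlim : Tendsto (fun t => unom (Sum.inl i) + ∑ S, Bdag (Sum.inl i) S * timeAverage (fun t =>
      (flowMatrix ι).mulVec (u t) S - (flowMatrix ι).mulVec unom S) t) atTop
      (𝓝 (unom (Sum.inl i) + ∑ S, Bdag (Sum.inl i) S * 0)) :=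
    tendsto_const_nhds.add (tendsto_finsetSum _ fun S _ => (hb S).const_mul _)
  simp only [mul_zero, Finset.sum_const_zero, add_zero] at hlim
  refine hlim.congr' ?_
  filter_upwards [eventually_gt_atTop 0] with t ht
  have hI : IntervalIntegrable (allocation u) volume 0 t := by
    have := h.integrable t ht.le
    rw [intervalIntegrable_iff] at this ⊢
    exact Integrable.of_eval fun i => this.eval (Sum.inl i)
  have hIS : ∀ S, IntervalIntegrable (fun τ => Bdag (Sum.inl i) S *
      ((flowMatrix ι).mulVec (u τ) S - (flowMatrix ι).mulVec unom S)) volume 0 t := fun S =>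
    (((h.intervalIntegrable_flow ht.le).apply S).sub intervalIntegrable_const).const_mul _
  have hae : ∫ τ in (0 : ℝ)..t, u τ (Sum.inl i) =
      ∫ τ in (0 : ℝ)..t, (unom (Sum.inl i) + ∑ S, Bdag (Sum.inl i) S *
        ((flowMatrix ι).mulVec (u τ) S - (flowMatrix ι).mulVec unom S)) := by
    refine intervalIntegral.integral_congr_ae ?_
    filter_upwards [(ae_restrict_iff' measurableSet_Ici).1 h.feedback] with τ hτ hmem
    rw [Set.uIoc_of_le ht.le] at hmem
    exact congrFun (eq_add_mulVec_of_mem_filippovSet hBdag (hτ hmem.1.le)) (Sum.inl i)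
  have hc : timeAverage (allocation u) t i = t⁻¹ * ∫ τ in (0 : ℝ)..t, u τ (Sum.inl i) := by
    rw [timeAverage, Pi.smul_apply, cumulative_apply hI]
    rfl
  rw [hc, hae, intervalIntegral.integral_add intervalIntegrable_const
    (intervalIntegrable_finsetSum _ fun S _ => hIS S), intervalIntegral.integral_finsetSum fun S _ => hIS S,
    intervalIntegral.integral_const]
  simp only [timeAverage, cumulative, intervalIntegral.integral_const_mul, smul_eq_mul, sub_zero,
    mul_add, Finset.mul_sum, inv_mul_cancel_left₀ ht.ne']
  congr 1
  exact Finset.sum_congr rfl fun S _ => by ring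

/-- The state integrates the excess rate minus the surplus, so adding the surplus back gives the
excess. -/
theorem excess_eq {φ : (Coalition ι → ℝ) → (ι ⊕ ProperCoalition ι → ℝ)}
    (h : IsFilippovSolution φ v x u) (hv : ∀ t, 0 ≤ t → IntervalIntegrable v volume 0 t)
    {t : ℝ} (ht : 0 ≤ t) :
    excess (allocation u) v (x 0) t = x t + cumulativeSurplus u t := by
  ext S
  have hI := h.integrable t ht
  have hs : IntervalIntegrable (fun τ => if h : S.1 ≠ Finset.univ then
      u τ (Sum.inr ⟨S.1, S.2, h⟩) else 0) volume 0 t := by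
    split_ifs
    · exact hI.apply _
    · exact intervalIntegrable_const
  have ha : IntervalIntegrable (fun τ => ∑ i ∈ S.1, u τ (Sum.inl i)) volume 0 t :=
    intervalIntegrable_finsetSum _ fun i _ => hI.apply _
  rw [Pi.add_apply, h.dynamics_apply hv ht, excess, cumulativeSurplus]
  simp only [flowMatrix_mulVec_apply, allocation, cumulative]
  rw [intervalIntegral.integral_sub (ha.sub hs) ((hv t ht).apply S),
    intervalIntegral.integral_sub ha hs,
    intervalIntegral.integral_finsetSum fun i _ => hI.apply _]
  ring

theorem monotoneOn_cumulativeSurplus {aMin aMax : ι → ℝ}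
    (hU : ∀ y : Coalition ι → ℝ, signController unom δ Bdag (sgn y) ∈ feasibleControls aMin aMax)
    (h : IsFilippovSolution (fun y => signController unom δ Bdag (sgn y)) v x u)
    (S : Coalition ι) : MonotoneOn (fun t => cumulativeSurplus u t S) (Set.Ici 0) := by
  intro a ha b hb hab
  have hI : ∀ t, 0 ≤ t → IntervalIntegrable (fun τ => if h : S.1 ≠ Finset.univ then
      u τ (Sum.inr ⟨S.1, S.2, h⟩) else 0) volume 0 t := fun t ht => by
    split_ifs
    · exact (h.integrable t ht).apply _
    · exact intervalIntegrable_const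
  have hab' := (hI a ha).symm.trans (hI b hb)
  simp only [cumulativeSurplus, cumulative]
  rw [← intervalIntegral.integral_add_adjacent_intervals (hI a ha) hab', le_add_iff_nonneg_right]
  refine intervalIntegral.integral_nonneg_of_ae_restrict hab ?_
  have hf := ae_restrict_of_ae_restrict_of_subset (s := Set.Icc a b)
    (fun s hs => le_trans (Set.mem_Ici.1 ha) hs.1) h.feedback
  filter_upwards [hf] with τ hτ
  split_ifs
  · exact surplus_nonneg_of_mem_filippovSet hU hτ _
  · exact le_rfl

end IsFilippovSolution

end ClosedLoop

/-! ### Main theorem -/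

theorem corollary2 {ι : Type*} [Fintype ι] [DecidableEq ι] [Nonempty ι]
    {Ω : Type*} [MeasurableSpace Ω] (μ : Measure Ω) [IsProbabilityMeasure μ]
    -- the coalition values
    (V : Set (Coalition ι → ℝ)) (P : Measure (Coalition ι → ℝ)) (vnom : Coalition ι → ℝ)
    (v : ℝ → Ω → Coalition ι → ℝ) (hv : IsBoundedMeanErgodic μ V P vnom v)
    -- the sign-based controller
    (aMin aMax : ι → ℝ) (unom : ι ⊕ ProperCoalition ι → ℝ)
    (hunom : (flowMatrix ι).mulVec unom = vnom)
    (Bdag : Matrix (ι ⊕ ProperCoalition ι) (Coalition ι) ℝ) (hBdag : flowMatrix ι * Bdag = 1)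
    (δ : ℝ) (hδ : 0 < δ)
    (hU : ∀ y : Coalition ι → ℝ, signController unom δ Bdag (sgn y) ∈ feasibleControls aMin aMax)
    -- the closed loop: state `x` and control `u`
    (x : ℝ → Ω → Coalition ι → ℝ) (u : ℝ → Ω → ι ⊕ ProperCoalition ι → ℝ)
    (hx : ∀ t, 0 ≤ t → Measurable (x t))
    (hsol : ∀ᵐ ω ∂μ, IsFilippovSolution (fun y => signController unom δ Bdag (sgn y))
      (fun t => v t ω) (fun t => x t ω) (fun t => u t ω))
    -- the state is independent of the fluctuations
    (hindep : ∀ t, 0 ≤ t → IndepFun (x t) (fun ω => v t ω - vnom) μ) :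
    (∀ᵐ ω ∂μ, ∃ c ∈ core vnom,
      Tendsto (timeAverage (allocation fun t => u t ω)) atTop (𝓝 c)) ∧
    (∀ᵐ ω ∂μ,
      Tendsto (fun t => Metric.infDist
        (WithLp.toLp 2 (excess (allocation fun t => u t ω) (fun t => v t ω) (x 0 ω) t))
        (nonnegOrthant (Coalition ι))) atTop (𝓝 0) ∧
      ∀ S : Coalition ι, ∃ l : EReal, 0 ≤ l ∧
        Tendsto (fun t =>
          (excess (allocation fun t => u t ω) (fun t => v t ω) (x 0 ω) t S : EReal))
          atTop (𝓝 l)) := by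
  subst hunom
  obtain ⟨M, hM⟩ := hv.bounded.exists_norm_le
  have hvm : ∀ ω, Measurable fun t => v t ω := fun ω => hv.measurable.comp measurable_prodMk_right
  have hbd : ∀ᵐ ω ∂μ, ∀ t, 0 ≤ t → ‖v t ω‖ ≤ M :=
    hv.mem.mono fun ω h t ht => hM _ (h t ht)
  have hvi : ∀ᵐ ω ∂μ, ∀ t, 0 ≤ t → IntervalIntegrable (fun t => v t ω) volume 0 t :=
    hbd.mono fun ω h t ht => intervalIntegrable_of_measurable_of_norm_le (hvm ω) h ht
  have hpath : ∀ᵐ ω ∂μ, ∀ S : Coalition ι,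
      IsSignFeedbackPath δ (M + |(flowMatrix ι).mulVec unom S|) (fun t => x t ω S)
      (fun t => (flowMatrix ι).mulVec (u t ω) S - (flowMatrix ι).mulVec unom S)
      (fun t => v t ω S - (flowMatrix ι).mulVec unom S) := by
    filter_upwards [hsol, hbd] with ω h hb S
    exact h.isSignFeedbackPath hBdag hδ.le (hvm ω) hb S
  have hlim : ∀ᵐ ω ∂μ, ∀ S : Coalition ι,
      Tendsto (timeAverage fun t => v t ω S - (flowMatrix ι).mulVec unom S) atTop (𝓝 0) := by
    filter_upwards [hv.ergodic, hvi] with ω he hi S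
    refine timeAverage_sub_const_tendsto_zero (fun t ht => (hi t ht).apply S) ?_
    refine (tendsto_pi_nhds.1 he S).congr' ?_
    filter_upwards [eventually_ge_atTop 0] with t ht
    rw [timeAverage, Pi.smul_apply, cumulative_apply (hi t ht)]
    rfl
  have hx0 : ∀ᵐ ω ∂μ, ∀ S : Coalition ι, Tendsto (fun t => x t ω S) atTop (𝓝 0) := by
    rw [ae_all_iff]
    intro S
    have hvS : ∀ t, Measurable fun ω => v t ω := fun t => hv.measurable.comp measurable_prodMk_left
    refine ae_tendsto_zero_of_isSignFeedbackPath hδ (hpath.mono fun ω h => h S)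
      (fun t ht => (measurable_pi_apply S).comp (hx t ht))
      (((measurable_pi_apply S).comp hv.measurable).sub_const _)
      (fun t ht => (hindep t ht).comp (measurable_pi_apply S) (measurable_pi_apply S))
      (fun t ht => ?_) (hlim.mono fun ω h => h S)
    have hint : Integrable (v t) μ :=
      Integrable.of_bound (hvS t).aestronglyMeasurable M (hbd.mono fun ω h => h t ht)
    rw [integral_sub (hint.eval S) (integrable_const _), ← eval_integral fun S => hint.eval S,
      hv.mean t ht]
    simp
  constructor
  · filter_upwards [hsol, hpath, hlim, hx0] with ω h hp hl h0
    -- At the zero sign vector the controller returns `unom` itself.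
    have hnom : unom ∈ feasibleControls aMin aMax := by
      have e : sgn (0 : Coalition ι → ℝ) = 0 := by ext; simp [sgn]
      simpa [e, signController] using hU 0
    exact ⟨_, mem_core_of_feasible hnom, h.tendsto_timeAverage_allocation hBdag fun S =>
      (hp S).timeAverage_feedback_tendsto_zero (hl S) (h0 S)⟩
  · filter_upwards [hsol, hvi, hx0] with ω h hi h0
    exact tendsto_nonnegOrthant_of_eq_add (fun t ht => h.excess_eq hi ht) (tendsto_pi_nhds.2 h0)
      (h.monotoneOn_cumulativeSurplus hU)
      (by ext S; simp [cumulativeSurplus, cumulative])
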